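/- Let $n,m\in\mathbb N$ and let $f_1,\dots,f_n:\mathbb R^m\to\mathbb R$ be differentiable convex functions such that each $\nabla f_i$ is continuous and each set $\{s:\nabla f_i(s)=0\}$ is nonempty and bounded. For $t\ge 0$ let $\mathcal G(t)$ be an undirected connected (simple) graph on $\{1,\dots,n\}$, and write $N_i(t)$ for the set of neighbours of $i$ in $\mathcal G(t)$. Assume that there is a constant $d_w>0$ such that any two distinct switching times of $\mathcal G$ (times $t>0$ near which $\mathcal G$ is not constant) are at least $d_w$ apart. Consider the single-integrator agents $\dot x_i=u_i$, $x_i(t)\in\mathbb R^m$, with $$u_i=\sum_{j\in N_i(t)}\frac{q_{ij}\,(x_j-x_i)}{\|x_j-x_i\|}-\nabla f_i(x_i),\qquad \dot q_{ij}=\begin{cases}\mathrm{sgn}(\|x_j-x_i\|),& j\in N_i(t),\\ 0,&\text{otherwise},\end{cases}\qquad q_{ij}(0)=q_{ji}(0)=0 .$$ Solutions of this closed-loop system $\dot z=F(t,z)$, with joint state $z=(x,q)$, are understood in the Filippov sense on $[0,\infty)$: $z$ is absolutely continuous on every interval $[0,T]$, and for almost every $t\ge 0$ $$\dot z(t)\in\bigcap_{\delta>0}\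 \bigcap_{\mathrm{Leb}(N)=0}\overline{\mathrm{co}}\,F\bigl(t,B(z(t),\delta)\setminus N\bigr).$$ Then for every such solution, with arbitrary initial positions $x_i(0)$: 1. the agents reach consensus in finite time, i.e. there is $T\ge 0$ with $x_i(t)=x_j(t)$ for all $i,j$ and all $t\ge T$; 2. the agents asymptotically solve the problem of minimizing $\sum_{i=1}^n f_i(y_i)$ subject to $y_i=y_j$ for all $i,j$: its set of minimizers is nonempty, $\sum_{i=1}^n f_i(x_i(t))$ converges to its minimum value as $t\to+\infty$, and the distance from $(x_1(t),\dots,x_n(t))$ to its set of minimizers tends to $0$. -/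

import Mathlib

open Set Filter Topology MeasureTheory

/-- The Filippov regularization of a (possibly discontinuous) vector field `F` at `(t, z)`:
the intersection, over all radii `δ > 0` and all Lebesgue-null sets `N`, of the closed convex
hulls of `F t (B(z, δ) \ N)`. -/
def filippovMap {S : Type*} [NormedAddCommGroup S] [NormedSpace ℝ S] [MeasureSpace S]
    (F : ℝ → S → S) (t : ℝ) (z : S) : Set S :=
  ⋂ (δ : ℝ) (_ : 0 < δ) (N : Set S) (_ : volume N = 0),
    closure (convexHull ℝ (F t '' (Metric.ball z δ \ N)))

/-- `z` is a Filippov solution of `ż = F(t, z)` on `[0, ∞)`: it is absolutely continuous on each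
compact interval `[0, T]`, and at almost every `t ≥ 0` it is differentiable with derivative in the
Filippov regularization of `F`. -/
def IsFilippovSolution {S : Type*} [NormedAddCommGroup S] [NormedSpace ℝ S] [MeasureSpace S]
    (F : ℝ → S → S) (z : ℝ → S) : Prop :=
  (∀ T : ℝ, 0 < T → AbsolutelyContinuousOnInterval z 0 T) ∧
  ∀ᵐ t ∂(volume.restrict (Ici (0 : ℝ))), ∃ v ∈ filippovMap F t (z t), HasDerivAt z v t

/-- The state `(x, q)` of the closed loop: agent positions `x i ∈ ℝᵐ` and gains `q i j ∈ ℝ`. -/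
abbrev AgentState (n m : ℕ) : Type :=
  (Fin n → EuclideanSpace ℝ (Fin m)) × (Fin n → Fin n → ℝ)

open Classical in
/-- The control input of agent `i` when the communication graph is `G`: the sum over the
neighbours `j` of `i` of `q i j (x j - x i) / ‖x j - x i‖`, minus the local gradient. -/
noncomputable def controlInput {n m : ℕ} (f : Fin n → EuclideanSpace ℝ (Fin m) → ℝ)
    (G : SimpleGraph (Fin n)) (z : AgentState n m) (i : Fin n) : EuclideanSpace ℝ (Fin m) :=
  (∑ j with G.Adj i j, (z.2 i j / ‖z.1 j - z.1 i‖) • (z.1 j - z.1 i)) - gradient (f i) (z.1 i)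

open Classical in
/-- The rate of change of the adaptive gain `q i j` when the communication graph is `G`. -/
noncomputable def gainRate {n m : ℕ} (G : SimpleGraph (Fin n)) (z : AgentState n m)
    (i j : Fin n) : ℝ :=
  if G.Adj i j then Real.sign ‖z.1 j - z.1 i‖ else 0

/-- The right-hand side of the closed loop of single integrators `ẋ i = u i` with the adaptive
algorithm, over the switching graph `G`. -/
noncomputable def closedLoop {n m : ℕ} (f : Fin n → EuclideanSpace ℝ (Fin m) → ℝ)
    (G : ℝ → SimpleGraph (Fin n)) (t : ℝ) (z : AgentState n m) : AgentState n m :=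
  (fun i => controlInput f (G t) z i, fun i j => gainRate (G t) z i j)

/-- The switching times of `G`: the times `t > 0` near which `G` is not constant. -/
def switchingTimes {n : ℕ} (G : ℝ → SimpleGraph (Fin n)) : Set ℝ :=
  {t | 0 < t ∧ ¬ ∀ᶠ s in 𝓝 t, G s = G t}

/-- Any two distinct switching times of `G` are at least `d` apart. -/
def HasDwellTime {n : ℕ} (G : ℝ → SimpleGraph (Fin n)) (d : ℝ) : Prop :=
  ∀ s ∈ switchingTimes G, ∀ t ∈ switchingTimes G, s < t → d ≤ t - s

/-- The feasible points of the problem: all agents agree. -/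
def consensusSet (n m : ℕ) : Set (Fin n → EuclideanSpace ℝ (Fin m)) :=
  {y | ∀ i j, y i = y j}

/-- The team objective `∑ i, f i (y i)`. -/
def teamObjective {n m : ℕ} (f : Fin n → EuclideanSpace ℝ (Fin m) → ℝ)
    (y : Fin n → EuclideanSpace ℝ (Fin m)) : ℝ :=
  ∑ i, f i (y i)

/-- The minimizers of the team objective subject to `y i = y j` for all `i, j`. -/
def teamMinimizers {n m : ℕ} (f : Fin n → EuclideanSpace ℝ (Fin m) → ℝ) :
    Set (Fin n → EuclideanSpace ℝ (Fin m)) :=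
  {y | y ∈ consensusSet n m ∧ IsMinOn (teamObjective f) (consensusSet n m) y}

/-!
A Filippov velocity is not determined where agents coincide, but every continuous linear functional
of the vector field that has a limit off null sets takes that limit on the whole regularization
(`apply_eq_of_mem_filippovMap`). Three consequences carry the argument.

* Coincidence of two agents is a null event when `0 < m`, so the gain of an active edge grows at
  unit rate, whether or not the agents have already met (`gain_velocity_of_mem_filippovMap`). Hence
  a pair with bounded gain has finite total activity. Because of the dwell time it is inactive from
  some time on, and all edges active late have arbitrarily large gains
  (`eventually_le_gain_of_adj`).
* For any centre `c`, the coupling contributes `-∑ q i j ‖x j - x i‖`, summed over the active edges,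
  to the derivative of `∑ i, ‖x i - c‖ ^ 2 / 2`, and the gradients contribute at most
  `∑ i, f i c - ∑ i, f i (x i)` (`sum_inner_velocity_of_mem_filippovMap`,
  `sum_inner_sub_velocity_le`).
* The coupling forces cancel in the sum of all velocities.

A convex function whose critical set is nonempty and bounded has bounded sublevel sets
(`ConvexOn.isBounded_sublevel`), so the second item with `c = 0` keeps the positions in a ball,
where the gradients are bounded. Taking the mean position for `c` and using large gains,
connectedness makes the disagreement `W = ∑ i, ‖x i - c‖ ^ 2` satisfy `W' ≤ -2√W`
(`deriv_disagreement_le`), so it vanishes after a finite time and stays zero.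

From then on the common position follows the gradient flow of the average of the `f i` by the third
item. The objective therefore decreases, and integrating the second item with a minimizer `c` shows
that its excess over the minimum is `O(1 / t)` (`tendsto_teamObjective`). Compactness of sublevel
sets turns this into convergence of the distance to the set of minimizers.
-/

/-! ### Absolutely continuous functions -/

theorem LipschitzOnWith.comp_absolutelyContinuousOnInterval {X Y : Type*} [PseudoMetricSpace X]
    [PseudoMetricSpace Y] {K : NNReal} {g : X → Y} {s : Set X} {f : ℝ → X} {a b : ℝ}
    (hg : LipschitzOnWith K g s) (hf : AbsolutelyContinuousOnInterval f a b)
    (hs : MapsTo f (uIcc a b) s) : AbsolutelyContinuousOnInterval (fun t => g (f t)) a b := by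
  rw [absolutelyContinuousOnInterval_iff] at hf ⊢
  intro ε hε
  obtain ⟨δ, hδ, h⟩ := hf (ε / (K + 1)) (by positivity)
  refine ⟨δ, hδ, fun E hE hE' => ?_⟩
  have h1 := h E hE hE'
  have h2 : ∑ i ∈ Finset.range E.1, dist (g (f (E.2 i).1)) (g (f (E.2 i).2)) ≤
      K * ∑ i ∈ Finset.range E.1, dist (f (E.2 i).1) (f (E.2 i).2) := by
    rw [Finset.mul_sum]
    refine Finset.sum_le_sum fun i hi => ?_
    have := hE.1 i hi
    exact hg.dist_le_mul _ (hs this.1) _ (hs this.2)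
  have h3 : 0 ≤ ∑ i ∈ Finset.range E.1, dist (f (E.2 i).1) (f (E.2 i).2) :=
    Finset.sum_nonneg fun _ _ => dist_nonneg
  have hK : (0 : ℝ) ≤ K := K.2
  rw [lt_div_iff₀ (by positivity)] at h1
  nlinarith

theorem AbsolutelyContinuousOnInterval.comp_contDiff {X Y : Type*} [NormedAddCommGroup X]
    [NormedSpace ℝ X] [ProperSpace X] [NormedAddCommGroup Y] [NormedSpace ℝ Y] {g : X → Y}
    {f : ℝ → X} {a b : ℝ} (hf : AbsolutelyContinuousOnInterval f a b) (hg : ContDiff ℝ 1 g) :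
    AbsolutelyContinuousOnInterval (fun t => g (f t)) a b := by
  obtain ⟨C, hC⟩ := hf.exists_bound
  obtain ⟨K, hK⟩ := (hg.contDiffOn (s := Metric.closedBall (0 : X) C)).exists_lipschitzOnWith
    one_ne_zero (convex_closedBall _ _) (isCompact_closedBall _ _)
  exact hK.comp_absolutelyContinuousOnInterval hf fun t ht => by simpa using hC t ht

/-- A one-sided mean value inequality that only needs the derivative bound almost everywhere. -/
theorem AbsolutelyContinuousOnInterval.sub_le_of_ae_hasDerivAt_le {φ : ℝ → ℝ} {a b c : ℝ}
    (hab : a ≤ b) (hφ : AbsolutelyContinuousOnInterval φ a b)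
    (h : ∀ᵐ t, t ∈ Ioo a b → ∃ v, HasDerivAt φ v t ∧ v ≤ c) : φ b - φ a ≤ c * (b - a) := by
  rw [← hφ.integral_deriv_eq_sub]
  have : ∫ _ in a..b, c = c * (b - a) := by simp [mul_comm]
  rw [← this, intervalIntegral.integral_of_le hab, intervalIntegral.integral_of_le hab,
    integral_Ioc_eq_integral_Ioo, integral_Ioc_eq_integral_Ioo]
  refine integral_mono_ae ?_ (by simp) ?_
  · have := (intervalIntegrable_iff_integrableOn_Ioo_of_le hab).1 hφ.intervalIntegrable_deriv
    exact this
  · refine (ae_restrict_iff' measurableSet_Ioo).2 ?_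
    filter_upwards [h] with t ht hmem
    obtain ⟨v, hv, hvc⟩ := ht hmem
    rw [hv.deriv]; exact hvc

/-- The differential inequality `φ' ≤ -2√φ` says that `√φ` decreases at unit rate while it is
positive, so `φ` vanishes no later than time `√(φ a)` after `a`. -/
theorem eq_zero_of_ae_hasDerivAt_le_neg_sqrt {φ : ℝ → ℝ} {a : ℝ} (h0 : ∀ t, a ≤ t → 0 ≤ φ t)
    (hac : ∀ b c, a ≤ b → b ≤ c → AbsolutelyContinuousOnInterval φ b c)
    (h : ∀ᵐ t, a < t → ∃ v, HasDerivAt φ v t ∧ v ≤ -(2 * √(φ t)))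
    {t : ℝ} (ht : a + √(φ a) ≤ t) : φ t = 0 := by
  have hat : a ≤ t := (le_add_of_nonneg_right (Real.sqrt_nonneg _)).trans ht
  by_contra hne
  have hpos : 0 < φ t := lt_of_le_of_ne (h0 t hat) (Ne.symm hne)
  have hanti : ∀ b c, a ≤ b → b ≤ c → φ c ≤ φ b := fun b c hab hbc => by
    have := (hac b c hab hbc).sub_le_of_ae_hasDerivAt_le (c := 0) hbc (by
      filter_upwards [h] with s hs hmem
      obtain ⟨v, hv, hv'⟩ := hs (hab.trans_lt hmem.1)
      exact ⟨v, hv, hv'.trans (by have := Real.sqrt_nonneg (φ s); linarith)⟩)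
    linarith
  obtain ⟨K, hK⟩ := (show ContDiffOn ℝ 1 Real.sqrt (Icc (φ t) (φ a)) from fun s hs =>
    (Real.contDiffAt_sqrt (hpos.trans_le hs.1).ne').contDiffWithinAt).exists_lipschitzOnWith
      one_ne_zero (convex_Icc _ _) isCompact_Icc
  have hsqrt := hK.comp_absolutelyContinuousOnInterval (hac a t le_rfl hat) (by
    rw [uIcc_of_le hat]
    exact fun s hs => ⟨hanti s t hs.1 hs.2, hanti a s le_rfl hs.1⟩)
  have := hsqrt.sub_le_of_ae_hasDerivAt_le (c := -1) hat (by
    filter_upwards [h] with s hs hmem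
    obtain ⟨v, hv, hv'⟩ := hs hmem.1
    have hs0 : 0 < φ s := hpos.trans_le (hanti s t hmem.1.le hmem.2.le)
    refine ⟨_, hv.sqrt hs0.ne', ?_⟩
    rw [div_le_iff₀ (by positivity)]
    linarith)
  have := Real.sqrt_pos.2 hpos
  linarith

/-! ### Convex functions with a bounded set of critical points -/

section Convex

variable {E : Type*} [NormedAddCommGroup E] [InnerProductSpace ℝ E]

theorem ConvexOn.inner_gradient_le_sub [CompleteSpace E] {f : E → ℝ} (hf : ConvexOn ℝ univ f)
    {x : E} (hx : DifferentiableAt ℝ f x) (y : E) :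
    inner ℝ (gradient f x) (y - x) ≤ f y - f x := by
  have hconv : ConvexOn ℝ univ (fun t : ℝ => f (AffineMap.lineMap x y t)) := by
    exact hf.comp_affineMap (AffineMap.lineMap x y : ℝ →ᵃ[ℝ] E)
  have hd : HasDerivAt (fun t : ℝ => f (AffineMap.lineMap x y t))
      (inner ℝ (gradient f x) (y - x)) 0 := by
    have h1 : HasFDerivAt f (fderiv ℝ f x) ((AffineMap.lineMap x y : ℝ →ᵃ[ℝ] E) 0) := by
      simpa using hx.hasFDerivAt
    have := h1.comp_hasDerivAt (0 : ℝ) AffineMap.hasDerivAt_lineMap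
    rwa [inner_gradient_left]
  simpa [slope_def_field] using hconv.le_slope_of_hasDerivAt (mem_univ 0) (mem_univ 1) one_pos hd

theorem ConvexOn.le_of_gradient_eq_zero [CompleteSpace E] {f : E → ℝ} (hf : ConvexOn ℝ univ f)
    {x : E} (hx : DifferentiableAt ℝ f x) (h0 : gradient f x = 0) (y : E) : f x ≤ f y := by
  have := hf.inner_gradient_le_sub hx y
  rw [h0, inner_zero_left] at this
  linarith

/-- On a sphere that encloses the critical set `f` exceeds its minimum by some `δ > 0`, and
convexity propagates this to growth of rate at least `δ / R` along every ray. -/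
theorem ConvexOn.isBounded_sublevel [FiniteDimensional ℝ E] {f : E → ℝ} (hf : ConvexOn ℝ univ f)
    (hd : Differentiable ℝ f) (hne : {s | gradient f s = 0}.Nonempty)
    (hb : Bornology.IsBounded {s | gradient f s = 0}) (c : ℝ) :
    Bornology.IsBounded {s | f s ≤ c} := by
  have : CompleteSpace E := FiniteDimensional.complete ℝ E
  have : ProperSpace E := FiniteDimensional.proper ℝ E
  obtain ⟨p, hp⟩ := hne
  have hmin : ∀ y, f p ≤ f y := hf.le_of_gradient_eq_zero (hd p) hp
  obtain ⟨r, hr0, hr⟩ := hb.subset_ball_lt 0 p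
  have hlt : ∀ s, dist s p = r → f p < f s := by
    intro s hs
    refine lt_of_le_of_ne (hmin s) fun heq => ?_
    have hloc : IsLocalMin f s := Eventually.of_forall fun y => heq ▸ hmin y
    have h0 : gradient f s = 0 := by simp [gradient, hloc.fderiv_eq_zero]
    have := hr h0
    rw [Metric.mem_ball] at this
    exact this.ne hs
  obtain ⟨δ, hδ, hδs⟩ : ∃ δ > 0, ∀ s, dist s p = r → f p + δ ≤ f s := by
    rcases (Metric.sphere p r).eq_empty_or_nonempty with he | hne
    · refine ⟨1, one_pos, fun s hs => ?_⟩
      have : s ∈ Metric.sphere p r := hs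
      simp [he] at this
    · obtain ⟨s₀, hs₀, hs₀m⟩ := (isCompact_sphere p r).exists_isMinOn hne hd.continuous.continuousOn
      refine ⟨f s₀ - f p, sub_pos.2 (hlt s₀ hs₀), fun s hs => ?_⟩
      have := hs₀m (show s ∈ Metric.sphere p r from hs)
      simp only [mem_ofPred_eq] at this
      linarith
  refine (Metric.isBounded_closedBall (x := p) (r := max r (r * (c - f p) / δ))).subset ?_
  intro s hs
  simp only [mem_ofPred_eq] at hs
  rw [Metric.mem_closedBall]
  by_contra! hcon
  obtain ⟨h1, h2⟩ := max_lt_iff.1 hcon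
  set ρ := dist s p with hρ
  have hρ0 : 0 < ρ := hr0.trans h1
  -- the point where the segment from `p` to `s` crosses the sphere
  have hy := hf.2 (mem_univ p) (mem_univ s)
    (show 0 ≤ 1 - r / ρ by rw [sub_nonneg, div_le_one hρ0]; exact h1.le)
    (show 0 ≤ r / ρ by positivity) (by ring)
  have hdist : dist ((1 - r / ρ) • p + (r / ρ) • s) p = r := by
    rw [dist_eq_norm, show (1 - r / ρ) • p + (r / ρ) • s - p = (r / ρ) • (s - p) by module,
      norm_smul, ← dist_eq_norm, ← hρ, Real.norm_of_nonneg (by positivity)]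
    field_simp
  have := hδs _ hdist
  rw [smul_eq_mul, smul_eq_mul] at hy
  have h3 : δ ≤ r / ρ * (f s - f p) := by linarith
  rw [div_mul_eq_mul_div, le_div_iff₀ hρ0] at h3
  rw [div_lt_iff₀ hδ] at h2
  nlinarith

end Convex

/-! ### The Filippov regularization of the closed loop -/

/-- A continuous linear image of the vector field that has an approximate limit at `z`, that is, a
limit after discarding a null set, takes this limit on the whole Filippov regularization. -/
theorem apply_eq_of_mem_filippovMap {S Y : Type*} [NormedAddCommGroup S] [NormedSpace ℝ S]
    [MeasureSpace S] [NormedAddCommGroup Y] [NormedSpace ℝ Y] {F : ℝ → S → S} {t : ℝ} {z v : S}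
    (hv : v ∈ filippovMap F t z) (L : S →L[ℝ] Y) {c : Y}
    (h : Tendsto (fun z' => L (F t z')) (𝓝 z ⊓ ae volume) (𝓝 c)) : L v = c := by
  refine eq_of_forall_dist_le fun ε hε => ?_
  obtain ⟨U, hU, V, hV, hUV⟩ := mem_inf_iff.1 (h (Metric.closedBall_mem_nhds c hε))
  obtain ⟨δ, hδ, hball⟩ := Metric.mem_nhds_iff.1 hU
  simp only [filippovMap, mem_iInter] at hv
  have hmem := hv δ hδ Vᶜ (mem_ae_iff.1 hV)
  have hclosed : IsClosed (L ⁻¹' Metric.closedBall c ε) :=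
    Metric.isClosed_closedBall.preimage L.continuous
  have hconv : Convex ℝ (L ⁻¹' Metric.closedBall c ε) :=
    (convex_closedBall c ε).linear_preimage L.toLinearMap
  refine closure_minimal (convexHull_min ?_ hconv) hclosed hmem
  rintro _ ⟨z', ⟨hz', hN⟩, rfl⟩
  have : z' ∈ U ∩ V := ⟨hball hz', not_not.1 hN⟩
  rw [← hUV] at this
  exact this

section ClosedLoop

variable {n m : ℕ}

theorem ae_ne_agentState (hm : 0 < m) {i j : Fin n} (hij : i ≠ j) :
    ∀ᵐ z : AgentState n m, z.1 i ≠ z.1 j := by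
  let p : Submodule ℝ (Fin n → EuclideanSpace ℝ (Fin m)) :=
    LinearMap.ker (LinearMap.proj (R := ℝ) (φ := fun _ : Fin n => EuclideanSpace ℝ (Fin m)) i -
      LinearMap.proj j)
  have hp : p ≠ ⊤ := by
    intro htop
    have : (Pi.single i (EuclideanSpace.single ⟨0, hm⟩ 1) :
        Fin n → EuclideanSpace ℝ (Fin m)) ∈ p := htop ▸ Submodule.mem_top
    simp [p, hij.symm] at this
  have h0 : ∀ᵐ y : Fin n → EuclideanSpace ℝ (Fin m), y ∉ p :=
    measure_eq_zero_iff_ae_notMem.1 (Measure.addHaar_submodule volume p hp)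
  have : (volume : Measure (Fin n → Fin n → ℝ)).IsAddHaarMeasure :=
    MeasureTheory.Measure.pi.isAddHaarMeasure (fun _ => volume)
  have hq : Measure.QuasiMeasurePreserving (Prod.fst : AgentState n m → _) volume volume :=
    Measure.quasiMeasurePreserving_fst
  filter_upwards [hq.ae h0] with z hz heq
  exact hz (by simp [p, heq])

/-- The gain of the ordered pair `(i, j)` as a continuous linear functional of the joint state. -/
def gainCLM (n m : ℕ) (i j : Fin n) : AgentState n m →L[ℝ] ℝ :=
  ContinuousLinearMap.proj (R := ℝ) (φ := fun _ : Fin n => ℝ) j ∘L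
    ContinuousLinearMap.proj (R := ℝ) (φ := fun _ : Fin n => Fin n → ℝ) i ∘L
      ContinuousLinearMap.snd ℝ _ _

@[simp]
theorem gainCLM_apply (i j : Fin n) (z : AgentState n m) : gainCLM n m i j z = z.2 i j := rfl

/-- Once agents occupy distinct positions the sign is `1`, and positions are distinct almost
everywhere. Hence an active gain grows at unit rate, even along trajectories in consensus. -/
theorem gain_velocity_of_mem_filippovMap (hm : 0 < m)
    {f : Fin n → EuclideanSpace ℝ (Fin m) → ℝ} {G : ℝ → SimpleGraph (Fin n)} {t : ℝ}
    {z v : AgentState n m} (hv : v ∈ filippovMap (closedLoop f G) t z) (i j : Fin n)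
    [Decidable ((G t).Adj i j)] :
    v.2 i j = if (G t).Adj i j then 1 else 0 := by
  refine apply_eq_of_mem_filippovMap hv (gainCLM n m i j) ?_
  refine tendsto_const_nhds.congr' ?_
  split_ifs with hadj
  · filter_upwards [(ae_ne_agentState hm hadj.ne).filter_mono inf_le_right] with z' hz'
    have : 0 < ‖z'.1 j - z'.1 i‖ := norm_pos_iff.2 (sub_ne_zero.2 hz'.symm)
    simp [closedLoop, gainRate, hadj, Real.sign_of_pos this]
  · simp [closedLoop, gainRate, hadj]

theorem gain_velocity_symm_of_mem_filippovMap
    {f : Fin n → EuclideanSpace ℝ (Fin m) → ℝ} {G : ℝ → SimpleGraph (Fin n)} {t : ℝ}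
    {z v : AgentState n m} (hv : v ∈ filippovMap (closedLoop f G) t z) (i j : Fin n) :
    v.2 i j = v.2 j i := by
  have : (gainCLM n m i j - gainCLM n m j i) v = 0 := by
    refine apply_eq_of_mem_filippovMap hv _ (tendsto_const_nhds.congr fun z' => ?_)
    by_cases hadj : (G t).Adj i j
    · simp [closedLoop, gainRate, hadj, hadj.symm, norm_sub_rev (z'.1 j)]
    · simp [closedLoop, gainRate, hadj, mt (G t).adj_symm hadj]
  exact sub_eq_zero.1 this

open Classical in
/-- The power that the coupling forces exert on test vectors `y i` whose differences are a multiple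
`κ` of the position differences: taking `y i = x i - c` gives dissipation along the edges, and a
constant `y` (where `κ = 0`) shows that the forces of the pairs cancel. The individual velocities
are not determined where agents coincide, but these combinations are. -/
theorem sum_inner_velocity_of_mem_filippovMap
    {f : Fin n → EuclideanSpace ℝ (Fin m) → ℝ} (hgrad : ∀ i, Continuous (gradient (f i)))
    {G : ℝ → SimpleGraph (Fin n)} {t : ℝ} {z v : AgentState n m}
    (hv : v ∈ filippovMap (closedLoop f G) t z) (hsymm : ∀ i j, z.2 i j = z.2 j i)
    (y : Fin n → EuclideanSpace ℝ (Fin m)) (κ : ℝ)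
    (hy : ∀ i j, y i - y j = κ • (z.1 i - z.1 j)) :
    ∑ i, inner ℝ (y i) (v.1 i) =
      -(κ / 2) * (∑ i, ∑ j with (G t).Adj i j, z.2 i j * ‖z.1 j - z.1 i‖) -
        ∑ i, inner ℝ (y i) (gradient (f i) (z.1 i)) := by
  let L : AgentState n m →L[ℝ] ℝ :=
    ∑ i, (innerSL ℝ (y i)) ∘L ContinuousLinearMap.proj i ∘L ContinuousLinearMap.fst ℝ _ _
  have hL : ∀ w : AgentState n m, L w = ∑ i, inner ℝ (y i) (w.1 i) := fun w => by simp [L]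
  rw [← hL v]
  refine apply_eq_of_mem_filippovMap hv L ?_
  refine Tendsto.mono_left ?_ inf_le_left
  -- the unit vector from agent `i` to agent `j`, or zero if they coincide
  let e : AgentState n m → Fin n → Fin n → EuclideanSpace ℝ (Fin m) :=
    fun z' i j => ‖z'.1 j - z'.1 i‖⁻¹ • (z'.1 j - z'.1 i)
  have he : ∀ z' i j, ‖e z' i j‖ ≤ 1 := fun z' i j => by
    rw [norm_smul, norm_inv, norm_norm]
    exact inv_mul_le_one
  have hpair : ∀ z', L (closedLoop f G t z') =
      (1 / 2) * (∑ i, ∑ j with (G t).Adj i j,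
        inner ℝ (z'.2 i j • y i - z'.2 j i • y j) (e z' i j)) -
        ∑ i, inner ℝ (y i) (gradient (f i) (z'.1 i)) := by
    intro z'
    have h1 : ∑ i, ∑ j with (G t).Adj i j, inner ℝ (z'.2 i j • y i) (e z' i j) =
        -∑ i, ∑ j with (G t).Adj i j, inner ℝ (z'.2 j i • y j) (e z' i j) := by
      simp only [Finset.sum_filter]
      rw [Finset.sum_comm, ← Finset.sum_neg_distrib]
      refine Finset.sum_congr rfl fun i _ => ?_
      rw [← Finset.sum_neg_distrib]
      refine Finset.sum_congr rfl fun j _ => ?_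
      rw [(G t).adj_comm]
      split_ifs
      · rw [← inner_neg_right]
        congr 1
        simp only [e]
        rw [norm_sub_rev, ← smul_neg, neg_sub]
      · simp
    have h2 : L (closedLoop f G t z') =
        ∑ i, ∑ j with (G t).Adj i j, inner ℝ (z'.2 i j • y i) (e z' i j) -
          ∑ i, inner ℝ (y i) (gradient (f i) (z'.1 i)) := by
      rw [hL, ← Finset.sum_sub_distrib]
      refine Finset.sum_congr rfl fun i _ => ?_
      simp only [closedLoop, controlInput, inner_sub_right (y i), inner_sum]
      congr 1
      refine Finset.sum_congr rfl fun j _ => ?_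
      simp only [e, inner_smul_left, inner_smul_right, div_eq_mul_inv, mul_assoc,
        RCLike.conj_to_real]
      ring
    simp only [inner_sub_left, Finset.sum_sub_distrib] at h1 h2 ⊢
    linarith
  simp only [hpair]
  have hterm : ∀ i j, Tendsto
      (fun z' : AgentState n m => inner ℝ (z'.2 i j • y i - z'.2 j i • y j) (e z' i j)) (𝓝 z)
      (𝓝 (-κ * (z.2 i j * ‖z.1 j - z.1 i‖))) := by
    intro i j
    have hA : Tendsto (fun z' : AgentState n m => z'.2 i j • y i - z'.2 j i • y j) (𝓝 z)
        (𝓝 ((z.2 i j * κ) • (z.1 i - z.1 j))) := by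
      have : Continuous fun z' : AgentState n m => z'.2 i j • y i - z'.2 j i • y j := by fun_prop
      convert this.tendsto z using 2
      rw [hsymm j i, ← smul_sub, hy, smul_smul]
    by_cases hij : z.1 i = z.1 j
    · rw [hij, sub_self, smul_zero] at hA
      rw [hij, sub_self, norm_zero, mul_zero, mul_zero]
      refine squeeze_zero_norm (fun z' => ?_) (by simpa using hA.norm)
      calc _ ≤ ‖z'.2 i j • y i - z'.2 j i • y j‖ * ‖e z' i j‖ := norm_inner_le_norm _ _
        _ ≤ _ := mul_le_of_le_one_right (norm_nonneg _) (he z' i j)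
    · have hne : ‖z.1 j - z.1 i‖ ≠ 0 := norm_ne_zero_iff.2 (sub_ne_zero.2 (Ne.symm hij))
      have hB : Tendsto (fun z' => e z' i j) (𝓝 z) (𝓝 (e z i j)) := by
        have h1 : ContinuousAt (fun z' : AgentState n m => z'.1 j - z'.1 i) z := by fun_prop
        exact (h1.norm.inv₀ hne).smul h1
      convert hA.inner (𝕜 := ℝ) hB using 2
      simp only [e]
      rw [← neg_sub (z.1 j) (z.1 i), smul_neg, inner_neg_left, inner_smul_left, inner_smul_right,
        real_inner_self_eq_norm_sq]
      simp only [RCLike.conj_to_real]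
      field_simp
  have hlim := ((tendsto_finsetSum (Finset.univ) fun i _ =>
    tendsto_finsetSum (Finset.univ.filter fun j => (G t).Adj i j) fun j _ =>
      hterm i j).const_mul (1 / 2 : ℝ)).sub
    (tendsto_finsetSum (Finset.univ) fun i _ =>
      ((show Continuous fun z' : AgentState n m => inner ℝ (y i) (gradient (f i) (z'.1 i)) by
        have := hgrad i; fun_prop).tendsto z))
  convert hlim using 2
  simp only [← Finset.mul_sum]
  ring

end ClosedLoop

/-! ### Functions along Filippov solutions -/

section Solution

variable {S : Type*} [NormedAddCommGroup S] [NormedSpace ℝ S] [MeasureSpace S]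
  {F : ℝ → S → S} {z : ℝ → S}

theorem IsFilippovSolution.ae_hasDerivAt (hsol : IsFilippovSolution F z) :
    ∀ᵐ t, 0 ≤ t → ∃ v ∈ filippovMap F t (z t), HasDerivAt z v t :=
  (ae_restrict_iff' measurableSet_Ici).1 hsol.2

theorem IsFilippovSolution.absolutelyContinuousOnInterval (hsol : IsFilippovSolution F z)
    {a b : ℝ} (ha : 0 ≤ a) (hab : a ≤ b) : AbsolutelyContinuousOnInterval z a b := by
  refine (hsol.1 (b + 1) (by linarith)).mono ?_
  rw [uIcc_of_le hab, uIcc_of_le (by linarith)]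
  exact Icc_subset_Icc ha (by linarith)

/-- A bound on the derivative of `g` along all Filippov velocities bounds the increments of `g`
along a solution. -/
theorem IsFilippovSolution.comp_sub_le [ProperSpace S] (hsol : IsFilippovSolution F z) {g : S → ℝ}
    (hg : ContDiff ℝ 1 g) {a b c : ℝ} (ha : 0 ≤ a) (hab : a ≤ b)
    (h : ∀ᵐ t, t ∈ Ioo a b → ∀ v ∈ filippovMap F t (z t), HasDerivAt z v t →
      ∃ d, HasDerivAt (fun s => g (z s)) d t ∧ d ≤ c) :
    g (z b) - g (z a) ≤ c * (b - a) := by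
  refine ((hsol.absolutelyContinuousOnInterval ha hab).comp_contDiff
    hg).sub_le_of_ae_hasDerivAt_le hab ?_
  filter_upwards [h, hsol.ae_hasDerivAt] with t ht hv hmem
  obtain ⟨v, hv, hd⟩ := hv (ha.trans hmem.1.le)
  exact ht hmem v hv hd

end Solution

/-! ### Switching times -/

section Switching

variable {n : ℕ} {G : ℝ → SimpleGraph (Fin n)} {d : ℝ}

theorem HasDwellTime.countable_switchingTimes (hG : HasDwellTime G d) (hd : 0 < d) :
    (switchingTimes G).Countable := by
  refine MapsTo.countable_of_injOn (f := fun t => ⌊t / d⌋) (mapsTo_univ _ _) ?_ countable_univ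
  intro s hs t ht hst
  have key : ∀ s ∈ switchingTimes G, ∀ t ∈ switchingTimes G, ⌊s / d⌋ = ⌊t / d⌋ → ¬ s < t := by
    intro s hs t ht hst hlt
    have h1 := hG s hs t ht hlt
    have h2 := Int.floor_le (s / d)
    have h3 := Int.lt_floor_add_one (t / d)
    rw [← hst] at h3
    have h4 : t / d < s / d + 1 := by linarith
    rw [div_lt_iff₀ hd, add_mul, div_mul_cancel₀ _ hd.ne'] at h4
    linarith
  exact le_antisymm (not_lt.1 (key t ht s hs hst.symm)) (not_lt.1 (key s hs t ht hst))

theorem HasDwellTime.ae_notMem_switchingTimes (hG : HasDwellTime G d) (hd : 0 < d) :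
    ∀ᵐ t, t ∉ switchingTimes G :=
  measure_eq_zero_iff_ae_notMem.1 ((hG.countable_switchingTimes hd).measure_zero _)

theorem graph_eq_of_isPreconnected {s : Set ℝ} (hs : IsPreconnected s) (hpos : s ⊆ Ioi 0)
    (hsw : Disjoint s (switchingTimes G)) {a b : ℝ} (ha : a ∈ s) (hb : b ∈ s) : G a = G b := by
  let _ : TopologicalSpace (SimpleGraph (Fin n)) := ⊥
  have : DiscreteTopology (SimpleGraph (Fin n)) := ⟨rfl⟩
  refine hs.constant (f := G) (fun t ht => ContinuousAt.continuousWithinAt ?_) ha hb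
  have : ∀ᶠ u in 𝓝 t, G u = G t := by
    by_contra hcon
    exact disjoint_left.1 hsw ht ⟨hpos ht, hcon⟩
  exact continuousAt_const.congr (this.mono fun _ h => h.symm)

/-- Two switching times on both sides of `t` are at least `d` apart, so the graph keeps its value
for time `d / 2` either after `t` or before `t`. -/
theorem HasDwellTime.eq_on_half_dwell (hG : HasDwellTime G d) (hd : 0 < d) {t : ℝ}
    (ht : d / 2 < t) (hsw : t ∉ switchingTimes G) :
    (∀ u ∈ Ioo t (t + d / 2), G u = G t) ∨ (∀ u ∈ Ioo (t - d / 2) t, G u = G t) := by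
  by_cases h : Disjoint (Ico t (t + d / 2)) (switchingTimes G)
  · exact Or.inl fun u hu => graph_eq_of_isPreconnected isPreconnected_Ico
      (fun s hs => (by linarith [hs.1] : (0 : ℝ) < s)) h ⟨hu.1.le, hu.2⟩ ⟨le_rfl, by linarith⟩
  · refine Or.inr fun u hu => graph_eq_of_isPreconnected (isPreconnected_Ioc (a := t - d / 2))
      (fun s hs => (by linarith [hs.1] : (0 : ℝ) < s)) ?_ ⟨hu.1, hu.2.le⟩ ⟨by linarith, le_rfl⟩
    obtain ⟨b, hb, hbs⟩ := not_disjoint_iff.1 h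
    refine disjoint_left.2 fun a ha has => ?_
    have hat : a ≠ t := fun h => hsw (h ▸ has)
    have := hG a has b hbs ((lt_of_le_of_ne ha.2 hat).trans_le hb.1)
    linarith [ha.1, hb.2]

end Switching

/-! ### Evolution of the gains -/

section Gains

variable {n m : ℕ} {f : Fin n → EuclideanSpace ℝ (Fin m) → ℝ} {G : ℝ → SimpleGraph (Fin n)}
  {x : ℝ → Fin n → EuclideanSpace ℝ (Fin m)} {q : ℝ → Fin n → Fin n → ℝ}

theorem gain_symm (hsol : IsFilippovSolution (closedLoop f G) (fun t => (x t, q t)))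
    (hq0 : ∀ i j, q 0 i j = 0) {t : ℝ} (ht : 0 ≤ t) (i j : Fin n) : q t i j = q t j i := by
  have key : ∀ i j, q t i j ≤ q t j i := fun i j => by
    have := hsol.comp_sub_le (g := gainCLM n m i j - gainCLM n m j i) (c := 0)
      (gainCLM n m i j - gainCLM n m j i).contDiff le_rfl ht (ae_of_all _ fun s _ v hv hd =>
        ⟨_, (gainCLM n m i j - gainCLM n m j i).hasFDerivAt.comp_hasDerivAt s hd, by
          simp [gain_velocity_symm_of_mem_filippovMap hv i j]⟩)
    simp [hq0] at this
    linarith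
  exact le_antisymm (key i j) (key j i)

theorem mul_sub_le_gain_sub (hsol : IsFilippovSolution (closedLoop f G) (fun t => (x t, q t)))
    {s t c : ℝ} (hs : 0 ≤ s) (hst : s ≤ t) {i j : Fin n}
    (h : ∀ u ∈ Ioo s t, ∀ v ∈ filippovMap (closedLoop f G) u (x u, q u), c ≤ v.2 i j) :
    c * (t - s) ≤ q t i j - q s i j := by
  have := hsol.comp_sub_le (g := -gainCLM n m i j) (c := -c) (-gainCLM n m i j).contDiff hs hst
    (ae_of_all _ fun u hu v hv hd =>
      ⟨_, (-gainCLM n m i j).hasFDerivAt.comp_hasDerivAt u hd, by simpa using h u hu v hv⟩)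
  simp at this
  linarith

theorem gain_mono (hsol : IsFilippovSolution (closedLoop f G) (fun t => (x t, q t)))
    (hm : 0 < m) {s t : ℝ} (hs : 0 ≤ s) (hst : s ≤ t) (i j : Fin n) : q s i j ≤ q t i j := by
  classical
  have := mul_sub_le_gain_sub hsol (c := 0) hs hst (i := i) (j := j) fun u _ v hv => by
    rw [gain_velocity_of_mem_filippovMap hm hv]
    split_ifs <;> norm_num
  linarith

theorem sub_le_gain_sub_of_adj
    (hsol : IsFilippovSolution (closedLoop f G) (fun t => (x t, q t)))
    (hm : 0 < m) {s t : ℝ} (hs : 0 ≤ s) (hst : s ≤ t) {i j : Fin n}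
    (hadj : ∀ u ∈ Ioo s t, (G u).Adj i j) : t - s ≤ q t i j - q s i j := by
  classical
  have := mul_sub_le_gain_sub hsol (c := 1) hs hst (i := i) (j := j) fun u hu v hv => by
    rw [gain_velocity_of_mem_filippovMap hm hv, if_pos (hadj u hu)]
  linarith

theorem gain_nonneg (hsol : IsFilippovSolution (closedLoop f G) (fun t => (x t, q t)))
    (hq0 : ∀ i j, q 0 i j = 0) (hm : 0 < m) {t : ℝ} (ht : 0 ≤ t) (i j : Fin n) : 0 ≤ q t i j :=
  hq0 i j ▸ gain_mono hsol hm le_rfl ht i j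

/-- A pair whose gain stays bounded is active for a finite total time, and the dwell time then
excludes activity at late times. So every pair that is active late has a large gain. -/
theorem eventually_le_gain_of_adj
    (hsol : IsFilippovSolution (closedLoop f G) (fun t => (x t, q t)))
    (hm : 0 < m) {d : ℝ} (hd : 0 < d) (hG : HasDwellTime G d) (K : ℝ) :
    ∀ᶠ t in atTop, t ∉ switchingTimes G → ∀ i j, (G t).Adj i j → K ≤ q t i j := by
  have hpair : ∀ i j, ∀ᶠ t in atTop, t ∉ switchingTimes G → (G t).Adj i j → K ≤ q t i j := by
    intro i j
    by_cases hb : ∃ t₀, 0 ≤ t₀ ∧ K ≤ q t₀ i j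
    · obtain ⟨t₀, ht₀, hK⟩ := hb
      filter_upwards [eventually_ge_atTop t₀] with t ht _ _
      exact hK.trans (gain_mono hsol hm ht₀ ht i j)
    · push Not at hb
      have hbdd : BddAbove ((fun t => q t i j) '' Ici 0) :=
        ⟨K, by rintro _ ⟨t, ht, rfl⟩; exact (hb t ht).le⟩
      obtain ⟨_, ⟨T, hT, rfl⟩, hTlt⟩ := exists_lt_of_lt_csSup
        (s := (fun t => q t i j) '' Ici 0) ⟨_, 0, self_mem_Ici, rfl⟩
        (sub_lt_self _ (half_pos hd))
      have hT : 0 ≤ T := hT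
      have hsup : ∀ t, 0 ≤ t → q t i j < q T i j + d / 2 := fun t ht => by
        have := le_csSup hbdd ⟨t, ht, rfl⟩
        dsimp only at this hTlt
        linarith
      filter_upwards [eventually_ge_atTop (T + d)] with t ht hsw hadj
      exfalso
      rcases hG.eq_on_half_dwell hd (by linarith) hsw with h | h
      · have h1 := sub_le_gain_sub_of_adj hsol hm (s := t) (t := t + d / 2) (by linarith)
          (by linarith) (i := i) (j := j) fun u hu => (h u hu).symm ▸ hadj
        have h2 := gain_mono hsol hm hT (by linarith : T ≤ t) i j
        linarith [hsup (t + d / 2) (by linarith)]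
      · have h1 := sub_le_gain_sub_of_adj hsol hm (s := t - d / 2) (t := t) (by linarith)
          (by linarith) (i := i) (j := j) fun u hu => (h u hu).symm ▸ hadj
        have h2 := gain_mono hsol hm hT (by linarith : T ≤ t - d / 2) i j
        linarith [hsup t (by linarith)]
  have := eventually_all.2 fun i => eventually_all.2 (hpair i)
  exact this.mono fun t ht hsw i j => ht i j hsw

end Gains

/-! ### The team objective -/

section Objective

variable {n m : ℕ} {f : Fin n → EuclideanSpace ℝ (Fin m) → ℝ}

theorem continuous_teamObjective (hdiff : ∀ i, Differentiable ℝ (f i)) :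
    Continuous (teamObjective f) :=
  continuous_finsetSum _ fun i _ => (hdiff i).continuous.comp (continuous_apply i)

theorem contDiff_of_continuous_gradient {E : Type*} [NormedAddCommGroup E] [InnerProductSpace ℝ E]
    [CompleteSpace E] {g : E → ℝ} (hd : Differentiable ℝ g) (hg : Continuous (gradient g)) :
    ContDiff ℝ 1 g := by
  refine contDiff_one_iff_fderiv.2 ⟨hd, ?_⟩
  rw [← toDual_comp_gradient]
  exact (LinearIsometryEquiv.continuous _).comp hg

theorem isBounded_teamObjective_le (hconv : ∀ i, ConvexOn ℝ univ (f i))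
    (hdiff : ∀ i, Differentiable ℝ (f i)) (hne : ∀ i, {s | gradient (f i) s = 0}.Nonempty)
    (hbdd : ∀ i, Bornology.IsBounded {s | gradient (f i) s = 0}) (c : ℝ) :
    Bornology.IsBounded {y | teamObjective f y ≤ c} := by
  choose p hp using hne
  have hmin : ∀ i s, f i (p i) ≤ f i s := fun i =>
    (hconv i).le_of_gradient_eq_zero (hdiff i _) (hp i)
  refine (Bornology.IsBounded.pi fun i => (hconv i).isBounded_sublevel (hdiff i) ⟨p i, hp i⟩
    (hbdd i) (c - ∑ j ∈ Finset.univ.erase i, f j (p j))).subset ?_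
  intro y hy i _
  have h1 : f i (y i) + ∑ j ∈ Finset.univ.erase i, f j (y j) ≤ c := by
    rw [Finset.add_sum_erase _ (fun j => f j (y j)) (Finset.mem_univ i)]; exact hy
  have h2 : ∑ j ∈ Finset.univ.erase i, f j (p j) ≤ ∑ j ∈ Finset.univ.erase i, f j (y j) :=
    Finset.sum_le_sum fun j _ => hmin j _
  simp only [mem_ofPred_eq]
  linarith

theorem isClosed_consensusSet : IsClosed (consensusSet n m) := by
  simp only [consensusSet, ofPred_forall]
  exact isClosed_iInter fun i => isClosed_iInter fun j =>
    isClosed_eq (continuous_apply i) (continuous_apply j)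

theorem teamMinimizers_nonempty (hdiff : ∀ i, Differentiable ℝ (f i))
    (hb : ∀ c, Bornology.IsBounded {y | teamObjective f y ≤ c}) :
    (teamMinimizers f).Nonempty := by
  have hcomp : IsCompact (consensusSet n m ∩ {y | teamObjective f y ≤ teamObjective f 0}) :=
    Metric.isCompact_of_isClosed_isBounded (isClosed_consensusSet.inter
      (isClosed_le (continuous_teamObjective hdiff) continuous_const)) ((hb _).subset
      inter_subset_right)
  obtain ⟨y, hy, hmin⟩ := hcomp.exists_isMinOn ⟨0, fun _ _ => rfl, le_refl (teamObjective f 0)⟩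
    (continuous_teamObjective hdiff).continuousOn
  refine ⟨y, hy.1, fun w hw => ?_⟩
  by_cases h : teamObjective f w ≤ teamObjective f 0
  · exact hmin ⟨hw, h⟩
  · exact (show teamObjective f y ≤ teamObjective f 0 from hy.2).trans (not_le.1 h).le

/-- A minimizing family of consensus points approaches the minimizers, by compactness of the
consensus points of bounded objective that keep a distance `ε` from them. -/
theorem tendsto_infDist_teamMinimizers {α : Type*} {l : Filter α}
    (hdiff : ∀ i, Differentiable ℝ (f i))
    (hb : ∀ c, Bornology.IsBounded {y | teamObjective f y ≤ c})
    {u : α → Fin n → EuclideanSpace ℝ (Fin m)} (hu : ∀ᶠ a in l, u a ∈ consensusSet n m)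
    {y : Fin n → EuclideanSpace ℝ (Fin m)} (hy : y ∈ teamMinimizers f)
    (hlim : Tendsto (fun a => teamObjective f (u a)) l (𝓝 (teamObjective f y))) :
    Tendsto (fun a => Metric.infDist (u a) (teamMinimizers f)) l (𝓝 0) := by
  have hcont := continuous_teamObjective hdiff
  refine tendsto_order.2 ⟨fun ε hε => Eventually.of_forall fun a =>
    hε.trans_le Metric.infDist_nonneg, fun ε hε => ?_⟩
  have hcomp : IsCompact ((consensusSet n m ∩ {w | teamObjective f w ≤ teamObjective f y + 1}) ∩
      {w | ε ≤ Metric.infDist w (teamMinimizers f)}) :=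
    Metric.isCompact_of_isClosed_isBounded ((isClosed_consensusSet.inter
      (isClosed_le hcont continuous_const)).inter
        (isClosed_le continuous_const (Metric.continuous_infDist_pt _)))
      ((hb _).subset (inter_subset_left.trans inter_subset_right))
  have h1 : ∀ᶠ a in l, teamObjective f (u a) < teamObjective f y + 1 :=
    hlim.eventually_lt_const (by linarith)
  rcases eq_empty_or_nonempty ((consensusSet n m ∩
      {w | teamObjective f w ≤ teamObjective f y + 1}) ∩
      {w | ε ≤ Metric.infDist w (teamMinimizers f)}) with he | hne
  · filter_upwards [hu, h1] with a ha h1a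
    by_contra! hcon
    exact (he ▸ (⟨⟨ha, h1a.le⟩, hcon⟩ : u a ∈ (consensusSet n m ∩
      {w | teamObjective f w ≤ teamObjective f y + 1}) ∩
      {w | ε ≤ Metric.infDist w (teamMinimizers f)}) : u a ∈ (∅ : Set _))
  · obtain ⟨w, hw, hmin⟩ := hcomp.exists_isMinOn hne hcont.continuousOn
    have hlt : teamObjective f y < teamObjective f w := by
      by_contra! hle
      have hwm : w ∈ teamMinimizers f := ⟨hw.1.1, fun w' hw' => hle.trans (hy.2 hw')⟩
      have h2 : ε ≤ Metric.infDist w (teamMinimizers f) := hw.2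
      rw [Metric.infDist_zero_of_mem hwm] at h2
      linarith
    filter_upwards [hu, h1, hlim.eventually_lt_const hlt] with a ha h1a h2a
    by_contra! hcon
    exact (lt_irrefl _) (h2a.trans_le (hmin ⟨⟨ha, h1a.le⟩, hcon⟩))

end Objective

/-! ### Boundedness of the positions -/

section Dynamics

variable {n m : ℕ} {f : Fin n → EuclideanSpace ℝ (Fin m) → ℝ} {G : ℝ → SimpleGraph (Fin n)}
  {x : ℝ → Fin n → EuclideanSpace ℝ (Fin m)} {q : ℝ → Fin n → Fin n → ℝ}

theorem hasDerivAt_position {v : AgentState n m} {t : ℝ}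
    (hd : HasDerivAt (fun s => (x s, q s)) v t) (i : Fin n) :
    HasDerivAt (fun s => x s i) (v.1 i) t :=
  hasDerivAt_pi.1 hd.fst i

theorem hasDerivAt_sum_norm_sub_sq {v : AgentState n m} {t : ℝ}
    (hd : HasDerivAt (fun s => (x s, q s)) v t) (c : EuclideanSpace ℝ (Fin m)) :
    HasDerivAt (fun s => ∑ i, ‖x s i - c‖ ^ 2) (2 * ∑ i, inner ℝ (x t i - c) (v.1 i)) t := by
  rw [Finset.mul_sum]
  exact HasDerivAt.fun_sum fun i _ => ((hasDerivAt_position hd i).sub_const c).norm_sq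

/-- The coupling forces only dissipate, and convexity bounds the drift of the gradients. -/
theorem sum_inner_sub_velocity_le (hconv : ∀ i, ConvexOn ℝ univ (f i))
    (hdiff : ∀ i, Differentiable ℝ (f i)) (hgrad : ∀ i, Continuous (gradient (f i)))
    (hsol : IsFilippovSolution (closedLoop f G) (fun t => (x t, q t)))
    (hq0 : ∀ i j, q 0 i j = 0) (hm : 0 < m) {t : ℝ} (ht : 0 ≤ t) {v : AgentState n m}
    (hv : v ∈ filippovMap (closedLoop f G) t (x t, q t)) (c : EuclideanSpace ℝ (Fin m)) :
    ∑ i, inner ℝ (x t i - c) (v.1 i) ≤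
      teamObjective f (fun _ => c) - teamObjective f (x t) := by
  classical
  rw [sum_inner_velocity_of_mem_filippovMap hgrad hv (fun i j => gain_symm hsol hq0 ht i j)
    (fun i => x t i - c) 1 (fun i j => by simp)]
  have h1 : 0 ≤ ∑ i, ∑ j with (G t).Adj i j, q t i j * ‖x t j - x t i‖ :=
    Finset.sum_nonneg fun i _ => Finset.sum_nonneg fun j _ =>
      mul_nonneg (gain_nonneg hsol hq0 hm ht i j) (norm_nonneg _)
  have h2 : teamObjective f (x t) - teamObjective f (fun _ => c) ≤
      ∑ i, inner ℝ (x t i - c) (gradient (f i) (x t i)) := by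
    simp only [teamObjective]
    rw [← Finset.sum_sub_distrib]
    refine Finset.sum_le_sum fun i _ => ?_
    have := (hconv i).inner_gradient_le_sub (hdiff i (x t i)) c
    rw [← neg_sub (x t i) c, inner_neg_right, real_inner_comm] at this
    linarith
  dsimp only
  linarith

theorem exists_norm_position_le (hconv : ∀ i, ConvexOn ℝ univ (f i))
    (hdiff : ∀ i, Differentiable ℝ (f i)) (hgrad : ∀ i, Continuous (gradient (f i)))
    (hb : ∀ c, Bornology.IsBounded {y | teamObjective f y ≤ c})
    (hsol : IsFilippovSolution (closedLoop f G) (fun t => (x t, q t)))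
    (hq0 : ∀ i j, q 0 i j = 0) (hm : 0 < m) :
    ∃ R, ∀ t, 0 ≤ t → ∀ i, ‖x t i‖ ≤ R := by
  let V : (Fin n → EuclideanSpace ℝ (Fin m)) → ℝ := fun y => ∑ i, ‖y i - 0‖ ^ 2
  have hVc : ContDiff ℝ 1 V :=
    ContDiff.sum fun i _ => ((contDiff_apply ℝ _ i).sub contDiff_const).norm_sq ℝ
  obtain ⟨R₀, hR₀⟩ := (hb (teamObjective f 0)).isCompact_closure.bddAbove_image
    hVc.continuous.continuousOn
  have hR₀' : ∀ y, R₀ < V y → teamObjective f 0 ≤ teamObjective f y := fun y hy => by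
    by_contra! hcon
    exact hy.not_ge (hR₀ ⟨y, subset_closure hcon.le, rfl⟩)
  have hV : ∀ t, 0 ≤ t → V (x t) ≤ max (V (x 0)) R₀ := by
    intro t ht
    by_contra! hcon
    have hxc : ContinuousOn (fun s => V (x s)) (Icc 0 t) := by
      have := (hsol.absolutelyContinuousOnInterval le_rfl ht).continuousOn
      rw [uIcc_of_le ht] at this
      exact hVc.continuous.comp_continuousOn this.fst
    -- the last time before `t` at which `V` does not exceed the bound
    obtain ⟨t₀, ⟨ht₀, hVt₀⟩, hlast⟩ := (isCompact_Icc.of_isClosed_subset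
      (hxc.preimage_isClosed_of_isClosed isClosed_Icc (isClosed_Iic (a := max (V (x 0)) R₀)))
      inter_subset_left).exists_isGreatest ⟨0, ⟨le_rfl, ht⟩, le_max_left (V (x 0)) R₀⟩
    have := hsol.comp_sub_le (g := fun z => V z.1) (c := 0) (hVc.comp contDiff_fst) ht₀.1 ht₀.2
      (ae_of_all _ fun s hs v hv hd => ⟨_, hasDerivAt_sum_norm_sub_sq hd 0, by
        have h1 := sum_inner_sub_velocity_le hconv hdiff hgrad hsol hq0 hm
          (ht₀.1.trans hs.1.le) hv 0
        have h2 : R₀ < V (x s) := by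
          by_contra! hle
          exact hs.1.not_ge (hlast ⟨⟨ht₀.1.trans hs.1.le, hs.2.le⟩, hle.trans (le_max_right _ _)⟩)
        have h3 : teamObjective f (fun _ => 0) ≤ teamObjective f (x s) := hR₀' _ h2
        linarith⟩)
    have hVt₀ : V (x t₀) ≤ max (V (x 0)) R₀ := hVt₀
    linarith
  refine ⟨√(max (V (x 0)) R₀), fun t ht i => Real.le_sqrt_of_sq_le ((hV t ht).trans' ?_)⟩
  simpa [V] using Finset.single_le_sum (f := fun i => ‖x t i‖ ^ 2) (fun j _ => sq_nonneg _)
    (Finset.mem_univ i)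

end Dynamics

/-! ### Consensus in finite time -/

section Mean

variable {n : ℕ} {E : Type*} [NormedAddCommGroup E]

theorem SimpleGraph.Walk.norm_sub_le {V : Type*} {H : SimpleGraph V} {y : V → E} {r : ℝ}
    (h : ∀ i j, H.Adj i j → ‖y j - y i‖ ≤ r) {i j : V} (p : H.Walk i j) :
    ‖y j - y i‖ ≤ p.length * r := by
  induction p with
  | nil => simp
  | @cons u v w hadj p ih =>
    have h1 := norm_add_le (y w - y v) (y v - y u)
    rw [sub_add_sub_cancel] at h1
    have h2 := h u v hadj
    rw [SimpleGraph.Walk.length_cons]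
    push_cast
    linarith

/-- Two vertices are joined by a path, which has fewer than `n` edges. -/
theorem SimpleGraph.Connected.norm_sub_le {H : SimpleGraph (Fin n)} (hH : H.Connected)
    {y : Fin n → E} {r : ℝ} (hr : 0 ≤ r) (h : ∀ i j, H.Adj i j → ‖y j - y i‖ ≤ r) (i j : Fin n) :
    ‖y j - y i‖ ≤ n * r := by
  obtain ⟨p, hp⟩ := (hH.preconnected i j).exists_isPath
  refine (p.norm_sub_le h).trans (mul_le_mul_of_nonneg_right ?_ hr)
  have := hp.length_lt
  rw [Fintype.card_fin] at this
  exact_mod_cast this.le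

variable [NormedSpace ℝ E]

/-- The arithmetic mean of the positions. -/
noncomputable def meanPosition (y : Fin n → E) : E := (n : ℝ)⁻¹ • ∑ i, y i

theorem sum_sub_meanPosition (hn : n ≠ 0) (y : Fin n → E) : ∑ i, (y i - meanPosition y) = 0 := by
  have : (n : ℝ) ≠ 0 := Nat.cast_ne_zero.2 hn
  rw [Finset.sum_sub_distrib, Finset.sum_const, Finset.card_univ, Fintype.card_fin, meanPosition,
    ← Nat.cast_smul_eq_nsmul ℝ, smul_smul, mul_inv_cancel₀ this, one_smul, sub_self]

theorem norm_sub_meanPosition_le (hn : n ≠ 0) {y : Fin n → E} {r : ℝ}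
    (h : ∀ i j, ‖y j - y i‖ ≤ r) (i : Fin n) : ‖y i - meanPosition y‖ ≤ r := by
  have hn' : (0 : ℝ) < n := Nat.cast_pos.2 (Nat.pos_of_ne_zero hn)
  have : y i - meanPosition y = (n : ℝ)⁻¹ • ∑ j, (y i - y j) := by
    rw [Finset.sum_sub_distrib, Finset.sum_const, Finset.card_univ, Fintype.card_fin, meanPosition,
      smul_sub, ← Nat.cast_smul_eq_nsmul ℝ, smul_smul, inv_mul_cancel₀ hn'.ne', one_smul]
  rw [this, norm_smul, norm_inv, RCLike.norm_natCast, inv_mul_le_iff₀ hn']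
  calc ‖∑ j, (y i - y j)‖ ≤ ∑ _j : Fin n, r := norm_sum_le_of_le _ fun j _ => h j i
    _ = n * r := by simp

end Mean

section Consensus

variable {n m : ℕ} {f : Fin n → EuclideanSpace ℝ (Fin m) → ℝ} {G : ℝ → SimpleGraph (Fin n)}
  {x : ℝ → Fin n → EuclideanSpace ℝ (Fin m)} {q : ℝ → Fin n → Fin n → ℝ}

/-- The motion of the mean does not contribute, because the deviations from it sum to zero. -/
theorem hasDerivAt_sum_norm_sub_meanPosition_sq (hn : n ≠ 0) {v : AgentState n m} {t : ℝ}
    (hd : HasDerivAt (fun s => (x s, q s)) v t) :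
    HasDerivAt (fun s => ∑ i, ‖x s i - meanPosition (x s)‖ ^ 2)
      (2 * ∑ i, inner ℝ (x t i - meanPosition (x t)) (v.1 i)) t := by
  have hmean : HasDerivAt (fun s => meanPosition (x s)) (meanPosition v.1) t :=
    (HasDerivAt.fun_sum (u := Finset.univ) fun i _ => hasDerivAt_position hd i).fun_const_smul _
  have hsum : ∑ i, inner ℝ (x t i - meanPosition (x t)) (v.1 i - meanPosition v.1) =
      ∑ i, inner ℝ (x t i - meanPosition (x t)) (v.1 i) := by
    simp only [inner_sub_right _ _ (meanPosition v.1), Finset.sum_sub_distrib, ← sum_inner]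
    rw [← Finset.sum_sub_distrib, sum_sub_meanPosition hn, inner_zero_left, sub_zero]
  rw [← hsum, Finset.mul_sum]
  exact HasDerivAt.fun_sum fun i _ => ((hasDerivAt_position hd i).fun_sub hmean).norm_sq

/-- With active gains at least `2 n² (C + 1)`, where `C` bounds the gradients, the coupling
outweighs the disagreement of the gradients. -/
theorem deriv_disagreement_le (hgrad : ∀ i, Continuous (gradient (f i))) {t : ℝ}
    (hn : n ≠ 0) (hconn : (G t).Connected) {z v : AgentState n m}
    (hv : v ∈ filippovMap (closedLoop f G) t z) (hsymm : ∀ i j, z.2 i j = z.2 j i) {C : ℝ}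
    (hC : ∀ i, ‖gradient (f i) (z.1 i)‖ ≤ C)
    (hq : ∀ i j, (G t).Adj i j → 2 * (n : ℝ) ^ 2 * (C + 1) ≤ z.2 i j) :
    2 * ∑ i, inner ℝ (z.1 i - meanPosition z.1) (v.1 i) ≤
      -(2 * √(∑ i, ‖z.1 i - meanPosition z.1‖ ^ 2)) := by
  classical
  have hn' : (1 : ℝ) ≤ n := Nat.one_le_cast.2 (Nat.one_le_iff_ne_zero.2 hn)
  rw [sum_inner_velocity_of_mem_filippovMap hgrad hv hsymm
    (fun i => z.1 i - meanPosition z.1) 1 (fun i j => by simp)]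
  -- `e` bounds every edge length, hence `n * e` bounds every deviation from the mean
  set e : ℝ := ∑ i, ∑ j with (G t).Adj i j, ‖z.1 j - z.1 i‖ with he
  have he0 : 0 ≤ e := Finset.sum_nonneg fun _ _ => Finset.sum_nonneg fun _ _ => norm_nonneg _
  have hedge : ∀ i j, (G t).Adj i j → ‖z.1 j - z.1 i‖ ≤ e := fun i j hadj =>
    (Finset.single_le_sum (f := fun j => ‖z.1 j - z.1 i‖) (fun _ _ => norm_nonneg _)
      (Finset.mem_filter.2 ⟨Finset.mem_univ j, hadj⟩)).trans
    (Finset.single_le_sum (f := fun i => ∑ j with (G t).Adj i j, ‖z.1 j - z.1 i‖)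
      (fun _ _ => Finset.sum_nonneg fun _ _ => norm_nonneg _) (Finset.mem_univ i))
  have hdev : ∀ i, ‖z.1 i - meanPosition z.1‖ ≤ n * e :=
    norm_sub_meanPosition_le hn (hconn.norm_sub_le he0 hedge)
  have h1 : 2 * (n : ℝ) ^ 2 * (C + 1) * e ≤
      ∑ i, ∑ j with (G t).Adj i j, z.2 i j * ‖z.1 j - z.1 i‖ := by
    rw [he, Finset.mul_sum]
    refine Finset.sum_le_sum fun i _ => ?_
    rw [Finset.mul_sum]
    exact Finset.sum_le_sum fun j hj =>
      mul_le_mul_of_nonneg_right (hq i j (Finset.mem_filter.1 hj).2) (norm_nonneg _)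
  have h2 : -((n : ℝ) ^ 2 * C * e) ≤
      ∑ i, inner ℝ (z.1 i - meanPosition z.1) (gradient (f i) (z.1 i)) := by
    calc -((n : ℝ) ^ 2 * C * e) = ∑ _i : Fin n, -(n * e * C) := by simp; ring
      _ ≤ _ := Finset.sum_le_sum fun i _ => neg_le_of_abs_le
        ((abs_real_inner_le_norm _ _).trans
          (mul_le_mul (hdev i) (hC i) (norm_nonneg _) (by positivity)))
  have h3 : √(∑ i, ‖z.1 i - meanPosition z.1‖ ^ 2) ≤ (n : ℝ) ^ 2 * e := by
    refine Real.sqrt_le_iff.2 ⟨by positivity, ?_⟩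
    calc ∑ i, ‖z.1 i - meanPosition z.1‖ ^ 2 ≤ ∑ _i : Fin n, (n * e) ^ 2 :=
          Finset.sum_le_sum fun i _ => pow_le_pow_left₀ (norm_nonneg _) (hdev i) 2
      _ = n * (n * e) ^ 2 := by simp
      _ ≤ n * (n * (n * e) ^ 2) := le_mul_of_one_le_left (by positivity) hn'
      _ = ((n : ℝ) ^ 2 * e) ^ 2 := by ring
  nlinarith

theorem exists_consensus (hgrad : ∀ i, Continuous (gradient (f i)))
    (hconn : ∀ t : ℝ, 0 ≤ t → (G t).Connected) {d : ℝ} (hd : 0 < d) (hG : HasDwellTime G d)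
    (hsol : IsFilippovSolution (closedLoop f G) (fun t => (x t, q t)))
    (hq0 : ∀ i j, q 0 i j = 0) (hm : 0 < m) (hx : ∃ R, ∀ t, 0 ≤ t → ∀ i, ‖x t i‖ ≤ R) :
    ∃ T : ℝ, 0 ≤ T ∧ ∀ t, T ≤ t → ∀ i j, x t i = x t j := by
  have hn : n ≠ 0 := by
    rintro rfl
    exact (hconn 0 le_rfl).nonempty.elim fun i => i.elim0
  obtain ⟨R, hR⟩ := hx
  have hC : ∀ i, ∃ C, ∀ s ∈ Metric.closedBall (0 : EuclideanSpace ℝ (Fin m)) R,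
      ‖gradient (f i) s‖ ≤ C := fun i =>
    (isCompact_closedBall _ _).exists_bound_of_continuousOn (hgrad i).continuousOn
  choose C hC using hC
  obtain ⟨C', hC'⟩ := (finite_range C).bddAbove
  have hgb : ∀ t, 0 ≤ t → ∀ i, ‖gradient (f i) (x t i)‖ ≤ C' := fun t ht i =>
    (hC i _ (by simpa using hR t ht i)).trans (hC' ⟨i, rfl⟩)
  obtain ⟨T₀, hT₀⟩ := eventually_atTop.1
    (eventually_le_gain_of_adj hsol hm hd hG (2 * (n : ℝ) ^ 2 * (C' + 1)))
  let T₁ := max T₀ 0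
  have hT₁ : 0 ≤ T₁ := le_max_right _ _
  let W : AgentState n m → ℝ := fun z => ∑ i, ‖z.1 i - meanPosition z.1‖ ^ 2
  have hW : ContDiff ℝ 1 W := by
    refine ContDiff.sum fun i _ => ContDiff.norm_sq ℝ ?_
    have hpos : ∀ j, ContDiff ℝ 1 fun z : AgentState n m => z.1 j := fun j =>
      (contDiff_apply ℝ _ j).comp contDiff_fst
    exact (hpos i).sub ((ContDiff.sum fun j _ => hpos j).const_smul _)
  have hzero : ∀ t, T₁ + √(W (x T₁, q T₁)) ≤ t → W (x t, q t) = 0 := fun t ht =>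
    eq_zero_of_ae_hasDerivAt_le_neg_sqrt (φ := fun s => W (x s, q s)) (a := T₁)
      (fun s _ => Finset.sum_nonneg fun i _ => sq_nonneg _)
      (fun b c hb hc => (hsol.absolutelyContinuousOnInterval (hT₁.trans hb) hc).comp_contDiff hW)
      (by
        filter_upwards [hsol.ae_hasDerivAt, hG.ae_notMem_switchingTimes hd] with s hs hsw hlt
        have hs0 : 0 ≤ s := hT₁.trans hlt.le
        obtain ⟨v, hv, hder⟩ := hs hs0
        exact ⟨_, hasDerivAt_sum_norm_sub_meanPosition_sq hn hder,
          deriv_disagreement_le hgrad hn (hconn s hs0) hv (gain_symm hsol hq0 hs0) (hgb s hs0)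
            (hT₀ s ((le_max_left _ _).trans hlt.le) hsw)⟩) ht
  refine ⟨T₁ + √(W (x T₁, q T₁)), add_nonneg hT₁ (Real.sqrt_nonneg _), fun t ht i j => ?_⟩
  have hmean : ∀ i, x t i = meanPosition (x t) := fun i => by
    have := (Finset.sum_eq_zero_iff_of_nonneg fun i _ => sq_nonneg _).1 (hzero t ht) i
      (Finset.mem_univ i)
    exact sub_eq_zero.1 (norm_eq_zero.1 (pow_eq_zero_iff two_ne_zero |>.1 this))
  rw [hmean i, hmean j]

end Consensus

/-! ### Gradient flow after consensus -/

section Optimality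

variable {n m : ℕ} {f : Fin n → EuclideanSpace ℝ (Fin m) → ℝ} {G : ℝ → SimpleGraph (Fin n)}
  {x : ℝ → Fin n → EuclideanSpace ℝ (Fin m)} {q : ℝ → Fin n → Fin n → ℝ}

/-- In consensus all agents share one velocity `w`, and the cancellation of the coupling forces
gives `n • w = -∑ i, ∇ f i`. -/
theorem teamObjective_antitone (hdiff : ∀ i, Differentiable ℝ (f i))
    (hgrad : ∀ i, Continuous (gradient (f i)))
    (hsol : IsFilippovSolution (closedLoop f G) (fun t => (x t, q t)))
    (hq0 : ∀ i j, q 0 i j = 0) {T : ℝ} (hT : 0 ≤ T)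
    (hcons : ∀ t, T ≤ t → ∀ i j, x t i = x t j) {s t : ℝ} (hs : T ≤ s) (hst : s ≤ t) :
    teamObjective f (x t) ≤ teamObjective f (x s) := by
  classical
  have hf : ContDiff ℝ 1 fun z : AgentState n m => teamObjective f z.1 :=
    ContDiff.sum fun i _ => (contDiff_of_continuous_gradient (hdiff i) (hgrad i)).comp
      ((contDiff_apply ℝ _ i).comp contDiff_fst)
  have := hsol.comp_sub_le (c := 0) hf (hT.trans hs) hst (ae_of_all _ fun u hu v hv hd => by
    have hu' : T < u := hs.trans_lt hu.1
    refine ⟨∑ i, inner ℝ (gradient (f i) (x u i)) (v.1 i),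
      HasDerivAt.fun_sum fun i _ => ?_, ?_⟩
    · have := (hdiff i (x u i)).hasFDerivAt.comp_hasDerivAt u (hasDerivAt_position hd i)
      rwa [← inner_gradient_left] at this
    · have hvel : ∀ i j, v.1 i = v.1 j := fun i j =>
        (hasDerivAt_position hd i).unique ((hasDerivAt_position hd j).congr_of_eventuallyEq
          ((eventually_gt_nhds hu').mono fun r hr => hcons r hr.le i j))
      set g := ∑ i, gradient (f i) (x u i) with hg
      have hflow := sum_inner_velocity_of_mem_filippovMap hgrad hv
        (gain_symm hsol hq0 (hT.trans hu'.le)) (fun _ => g) 0 (fun i j => by simp)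
      rw [← inner_sum, ← inner_sum, ← hg, zero_div, neg_zero, zero_mul, zero_sub,
        real_inner_self_eq_norm_sq] at hflow
      rcases isEmpty_or_nonempty (Fin n) with h | ⟨⟨k⟩⟩
      · simp
      · have h1 : ∑ i, v.1 i = (n : ℝ) • v.1 k := by
          rw [Finset.sum_congr rfl fun i _ => hvel i k]
          simp [Nat.cast_smul_eq_nsmul]
        have h2 : ∑ i, inner ℝ (gradient (f i) (x u i)) (v.1 i) = inner ℝ g (v.1 k) := by
          rw [Finset.sum_congr rfl fun i _ => by rw [hvel i k], ← sum_inner]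
        rw [h1, inner_smul_right] at hflow
        have hn : (0 : ℝ) < n := Nat.cast_pos.2 k.pos
        rw [h2]
        nlinarith [sq_nonneg ‖g‖])
  linarith

/-- For a minimizer `y` the squared distance of the positions to `y` decreases at least at rate
`2 (teamObjective f (x t) - teamObjective f y)`. Since this excess is nonnegative and nonincreasing
after consensus, it is `O(1 / t)`. -/
theorem tendsto_teamObjective (hconv : ∀ i, ConvexOn ℝ univ (f i))
    (hdiff : ∀ i, Differentiable ℝ (f i)) (hgrad : ∀ i, Continuous (gradient (f i)))
    (hsol : IsFilippovSolution (closedLoop f G) (fun t => (x t, q t)))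
    (hq0 : ∀ i j, q 0 i j = 0) (hm : 0 < m) {T : ℝ} (hT : 0 ≤ T)
    (hcons : ∀ t, T ≤ t → ∀ i j, x t i = x t j) {c : EuclideanSpace ℝ (Fin m)}
    (hc : (fun _ => c) ∈ teamMinimizers f) :
    Tendsto (fun t => teamObjective f (x t)) atTop (𝓝 (teamObjective f fun _ => c)) := by
  let V : AgentState n m → ℝ := fun z => ∑ i, ‖z.1 i - c‖ ^ 2
  have hV : ContDiff ℝ 1 V := ContDiff.sum fun i _ => ContDiff.norm_sq ℝ
    (((contDiff_apply ℝ _ i).comp contDiff_fst).sub contDiff_const)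
  have hupper : ∀ t, T < t → teamObjective f (x t) ≤
      (teamObjective f fun _ => c) + V (x T, q T) / 2 / (t - T) := by
    intro t ht
    have h1 := hsol.comp_sub_le (c := 2 * ((teamObjective f fun _ => c) - teamObjective f (x t)))
      hV hT ht.le (ae_of_all _ fun s hs v hv hd => ⟨_, hasDerivAt_sum_norm_sub_sq hd c, by
        have h1 := sum_inner_sub_velocity_le hconv hdiff hgrad hsol hq0 hm
          (hT.trans hs.1.le) hv c
        have h2 := teamObjective_antitone hdiff hgrad hsol hq0 hT hcons hs.1.le hs.2.le
        linarith⟩)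
    have h2 : 0 ≤ V (x t, q t) := Finset.sum_nonneg fun i _ => sq_nonneg _
    rw [← sub_le_iff_le_add', le_div_iff₀ (sub_pos.2 ht)]
    linarith
  have hlim : Tendsto (fun t => (teamObjective f fun _ => c) + V (x T, q T) / 2 / (t - T)) atTop
      (𝓝 (teamObjective f fun _ => c)) := by
    have hT' := tendsto_atTop_add_const_right atTop (-T) tendsto_id
    simpa [← sub_eq_add_neg] using
      (hT'.const_div_atTop (V (x T, q T) / 2)).const_add (teamObjective f fun _ => c)
  refine tendsto_of_tendsto_of_tendsto_of_le_of_le' tendsto_const_nhds hlim ?_ ?_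
  · filter_upwards [eventually_ge_atTop T] with t ht
    exact hc.2 (hcons t ht)
  · filter_upwards [eventually_gt_atTop T] with t ht using hupper t ht

end Optimality

/-! ### Convergence of the closed loop -/

theorem theorem1 (n m : ℕ) (f : Fin n → EuclideanSpace ℝ (Fin m) → ℝ)
    (hconv : ∀ i, ConvexOn ℝ Set.univ (f i))
    (hdiff : ∀ i, Differentiable ℝ (f i))
    (hgrad : ∀ i, Continuous (gradient (f i)))
    (hne : ∀ i, {s | gradient (f i) s = 0}.Nonempty)
    (hbdd : ∀ i, Bornology.IsBounded {s | gradient (f i) s = 0})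
    (G : ℝ → SimpleGraph (Fin n))
    (hconn : ∀ t : ℝ, 0 ≤ t → (G t).Connected)
    (d : ℝ) (hd : 0 < d) (hdwell : HasDwellTime G d)
    (x : ℝ → Fin n → EuclideanSpace ℝ (Fin m)) (q : ℝ → Fin n → Fin n → ℝ)
    (hsol : IsFilippovSolution (closedLoop f G) (fun t => (x t, q t)))
    (hq0 : ∀ i j, q 0 i j = 0) :
    (∃ T : ℝ, 0 ≤ T ∧ ∀ t, T ≤ t → ∀ i j, x t i = x t j) ∧
    (teamMinimizers f).Nonempty ∧
    (∀ y ∈ teamMinimizers f,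
      Tendsto (fun t => teamObjective f (x t)) atTop (𝓝 (teamObjective f y))) ∧
    Tendsto (fun t => Metric.infDist (x t) (teamMinimizers f)) atTop (𝓝 0) := by

  have hb : ∀ c, Bornology.IsBounded {y | teamObjective f y ≤ c} :=
    isBounded_teamObjective_le hconv hdiff hne hbdd
  obtain ⟨y₀, hy₀⟩ := teamMinimizers_nonempty hdiff hb
  rcases Nat.eq_zero_or_pos m with rfl | hm
  · -- all positions coincide in `ℝ⁰`
    have hx : ∀ t, x t = y₀ := fun t => Subsingleton.elim _ _
    refine ⟨⟨0, le_rfl, fun t _ i j => Subsingleton.elim _ _⟩, ⟨y₀, hy₀⟩, fun y _ => ?_, ?_⟩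
    · rw [Subsingleton.elim y y₀]
      simp only [hx]
      exact tendsto_const_nhds
    · simp only [hx, Metric.infDist_zero_of_mem hy₀]
      exact tendsto_const_nhds
  obtain ⟨T, hT, hcons⟩ := exists_consensus hgrad hconn hd hdwell hsol hq0 hm
    (exists_norm_position_le hconv hdiff hgrad hb hsol hq0 hm)
  have hlim : ∀ y ∈ teamMinimizers f,
      Tendsto (fun t => teamObjective f (x t)) atTop (𝓝 (teamObjective f y)) := by
    intro y hy
    obtain ⟨k⟩ := (hconn 0 le_rfl).nonempty
    have hyk : y = fun _ => y k := funext fun i => hy.1 i k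
    rw [hyk] at hy ⊢
    exact tendsto_teamObjective hconv hdiff hgrad hsol hq0 hm hT hcons hy
  refine ⟨⟨T, hT, hcons⟩, ⟨y₀, hy₀⟩, hlim, tendsto_infDist_teamMinimizers hdiff hb ?_ hy₀
    (hlim y₀ hy₀)⟩
  filter_upwards [eventually_ge_atTop T] with t ht using hcons t ht
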